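/- Theorem D. For every integer $n\ge 1$ and every $d\ge 0$ there is a constant $C_0>0$, depending only on $n$ and $d$, such that the following holds. Let $f:\mathbb R^n\to\mathbb R$ belong to $BMO(\mathbb R^n)$, that is, $f$ is locally integrable and $$\|f\|_{BMO(\mathbb R^n)}=\sup_{x\in\mathbb R^n,\ r>0}\frac1{|B(x,r)|}\int_{B(x,r)}\bigl|f(y)-\{f\}_{B(x,r)}\bigr|\,dy<\infty,\qquad \{f\}_{B(x,r)}=\frac1{|B(x,r)|}\int_{B(x,r)}f(y)\,dy.$$ Assume that the support of $f$ (the complement of the largest open set on which $f=0$ almost everywhere) is bounded with diameter at most $d$, and let $g:\mathbb R^n\to\mathbb R$ belong to $L_1(\mathbb R^n)\cap L_\infty(\mathbb R^n)$. Then $fg$ is integrable and $$\Bigl|\int_{\mathbb R^n}fg\,dx\Bigr|\le C_0\,\|f\|_{BMO(\mathbb R^n)}\,\|g\|_{L_1(\mathbb R^n)}\Bigl[\bigl|\ln\|g\|_{L_1(\mathbb R^n)}\bigr|+\ln\bigl(e+\|g\|_{L_\infty(\mathbb R^n)}\bigr)\Bigr],$$ where the right-hand side is read as $0$ if $\|g\|_{L_1(\mathbb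 R^n)}=0$. -/

import Mathlib

open MeasureTheory
open scoped ENNReal

/-- The mean oscillation seminorm on `ℝⁿ`, with values in `[0, ∞]`: the supremum over all balls
`B(x, r)`, `r > 0`, of the average over `B(x, r)` of `|f - {f}_{B(x, r)}|`, where
`{f}_{B(x, r)}` is the average of `f` over the ball. -/
noncomputable def bmoSeminorm {n : ℕ} (f : EuclideanSpace ℝ (Fin n) → ℝ) : ℝ≥0∞ :=
  ⨆ (x : EuclideanSpace ℝ (Fin n)) (r : ℝ) (_ : 0 < r),
    ⨍⁻ y in Metric.ball x r, ‖f y - ⨍ z in Metric.ball x r, f z ∂volume‖ₑ ∂volume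

/-- `f ∈ BMO(ℝⁿ)`: `f` is locally integrable and its mean oscillation seminorm is finite. -/
def MemBMO {n : ℕ} (f : EuclideanSpace ℝ (Fin n) → ℝ) : Prop :=
  LocallyIntegrable f volume ∧ bmoSeminorm f < ∞

/-- The support of a function that is defined up to null sets: the complement of the largest open
set on which `f` vanishes almost everywhere. -/
def essSupport {n : ℕ} (f : EuclideanSpace ℝ (Fin n) → ℝ) : Set (EuclideanSpace ℝ (Fin n)) :=
  (⋃₀ {U | IsOpen U ∧ f =ᵐ[volume.restrict U] 0})ᶜ

open Filter Topology Metric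

/-! A function of bounded mean oscillation exceeds high levels only on exponentially small sets
(John–Nirenberg). With `c` a dimensional multiple of the seminorm, `{k * c < |f|}` has measure at
most `2⁻ᵏ V`, where `V` bounds the measure of the support (`volume_superlevel_le`). Slicing `|f|` at
the levels `k * c` bounds the integral of `|f g|` by `c` times the sum over `k` of `min (‖g‖₁, 2⁻ᵏ V
‖g‖_∞)` (`lintegral_enorm_mul_le`). About `log₂ (V ‖g‖_∞ / ‖g‖₁)` terms cost `‖g‖₁` each and the
rest form a geometric tail, whence the logarithm. -/

theorem quarter_mul_le_half_mul {v w : ℝ≥0∞} (hvt : v ≠ ∞) (hwt : w ≠ ∞)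
    (hhalf : v ≤ ENNReal.ofReal 4⁻¹ * v + w) : ENNReal.ofReal 4⁻¹ * v ≤ 2⁻¹ * w := by
  lift v to NNReal using hvt
  lift w to NNReal using hwt
  rw [← ENNReal.ofReal_coe_nnreal, ← ENNReal.ofReal_coe_nnreal (p := w)] at *
  rw [← ENNReal.ofReal_mul (by norm_num), ← ENNReal.ofReal_add (by positivity) w.coe_nonneg,
    ENNReal.ofReal_le_ofReal_iff (by positivity)] at hhalf
  rw [← ENNReal.ofReal_ofNat 2, ← ENNReal.ofReal_inv_of_pos (by norm_num),
    ← ENNReal.ofReal_mul (by norm_num), ← ENNReal.ofReal_mul (by norm_num)]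
  exact ENNReal.ofReal_le_ofReal (by linarith)

/-! ### John–Nirenberg decay by a stopping-radius argument -/

section OscillationEstimates

variable {n : ℕ} {f : EuclideanSpace ℝ (Fin n) → ℝ}

theorem volume_ball_inter_oscillation_le (hf : AEStronglyMeasurable f volume) {K : ℝ}
    (hK : bmoSeminorm f ≤ ENNReal.ofReal K) (x : EuclideanSpace ℝ (Fin n)) {r : ℝ} (hr : 0 < r)
    {l : ℝ} (hl : 0 < l) :
    volume ({y | l ≤ |f y - ⨍ z in ball x r, f z|} ∩ ball x r) ≤
      ENNReal.ofReal (K / l) * volume (ball x r) := by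
  set a := ⨍ z in ball x r, f z with ha
  have hosc : ⨍⁻ y in ball x r, ‖f y - a‖ₑ ∂volume ≤ ENNReal.ofReal K := by
    refine le_trans ?_ hK
    unfold bmoSeminorm
    refine le_iSup_of_le x (le_iSup_of_le r ?_)
    exact le_iSup (fun _ : 0 < r => ⨍⁻ y in ball x r, ‖f y - a‖ₑ ∂volume) hr
  rw [setLAverage_eq] at hosc
  have hv0 : volume (ball x r) ≠ 0 := (measure_ball_pos volume x hr).ne'
  have hvt : volume (ball x r) ≠ ∞ := measure_ball_lt_top.ne
  rw [ENNReal.div_le_iff hv0 hvt] at hosc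
  have hm : AEMeasurable (fun y => ‖f y - a‖ₑ) (volume.restrict (ball x r)) :=
    (hf.restrict.sub aestronglyMeasurable_const).enorm
  have h := meas_ge_le_lintegral_div hm (ε := ENNReal.ofReal l) (by simpa using hl)
    ENNReal.ofReal_ne_top
  rw [Measure.restrict_apply' measurableSet_ball] at h
  have hset : {y | ENNReal.ofReal l ≤ ‖f y - a‖ₑ} = {y | l ≤ |f y - a|} := by
    ext y
    simp only [Set.mem_ofPred_eq, Real.enorm_eq_ofReal_abs]
    exact ENNReal.ofReal_le_ofReal_iff (abs_nonneg _)
  rw [hset] at h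
  refine h.trans ?_
  rw [ENNReal.ofReal_div_of_pos hl, ENNReal.div_le_iff (by simpa using hl) ENNReal.ofReal_ne_top]
  refine hosc.trans (le_of_eq ?_)
  rw [mul_right_comm, ENNReal.div_mul_cancel (by simpa using hl) ENNReal.ofReal_ne_top]

/-- Bounds the stopping radii, as Vitali's covering lemma requires: the average is at most `‖f‖₁`
over the volume of the ball, and `r ≤ r ^ n` for `1 ≤ r`. -/
theorem exists_abs_average_ball_le (hn : 1 ≤ n) (hf : Integrable f volume) {s : ℝ} (hs : 0 < s) :
    ∃ R : ℝ, ∀ x : EuclideanSpace ℝ (Fin n), ∀ r, R < r → |⨍ z in ball x r, f z| ≤ s := by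
  set v := volume.real (ball (0 : EuclideanSpace ℝ (Fin n)) 1) with hv
  have hvpos : 0 < v := 
    ENNReal.toReal_pos (measure_ball_pos volume _ one_pos).ne' measure_ball_lt_top.ne
  refine ⟨max 1 ((∫ z, |f z|) / (v * s)), fun x r hr => ?_⟩
  obtain ⟨hr1, hr2⟩ := max_lt_iff.1 hr
  have hball : volume.real (ball x r) = r ^ n * v := by
    rw [hv, Measure.real, Measure.real, Measure.addHaar_ball_of_pos volume x (by linarith),
      ENNReal.toReal_mul, ENNReal.toReal_ofReal (by positivity), finrank_euclideanSpace_fin]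
  have hrn : r ≤ r ^ n := le_self_pow₀ hr1.le (by omega)
  have hint : |∫ z in ball x r, f z| ≤ ∫ z, |f z| :=
    (abs_integral_le_integral_abs).trans
      (setIntegral_le_integral hf.abs (Eventually.of_forall fun z => abs_nonneg _))
  rw [setAverage_eq, hball, smul_eq_mul, abs_mul, abs_of_nonneg (by positivity),
    inv_mul_le_iff₀ (by positivity)]
  rw [div_lt_iff₀ (by positivity)] at hr2
  nlinarith [mul_le_mul_of_nonneg_right hrn (mul_pos hvpos hs).le]

/-- Among the radii `6 ^ k * r₀`, with `r₀` so small that the average exceeds `s`, take the one just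
before the average first drops to `s`. -/
theorem exists_stopping_radius {y : EuclideanSpace ℝ (Fin n)} {s R : ℝ}
    (hR : ∀ r, R < r → |⨍ z in ball y r, f z| ≤ s)
    (hy : Tendsto (fun r => ⨍ z in ball y r, f z) (𝓝[>] 0) (𝓝 (f y))) (hs : s < |f y|) :
    ∃ r, 0 < r ∧ r ≤ R ∧ s < |⨍ z in ball y r, f z| ∧ |⨍ z in ball y (6 * r), f z| ≤ s := by
  obtain ⟨r₀, hr₀, hr₀pos⟩ :=
    ((hy.abs.eventually_const_lt hs).and self_mem_nhdsWithin).exists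
  have hr₀pos : 0 < r₀ := hr₀pos
  have hex : ∃ k : ℕ, |⨍ z in ball y (6 ^ k * r₀), f z| ≤ s := by
    obtain ⟨k, hk⟩ := pow_unbounded_of_one_lt (R / r₀) (by norm_num : (1 : ℝ) < 6)
    exact ⟨k, hR _ ((div_lt_iff₀ hr₀pos).1 hk)⟩
  classical
  obtain ⟨k, hk, hmin⟩ : ∃ k : ℕ, |⨍ z in ball y (6 ^ k * r₀), f z| ≤ s ∧
      ∀ m < k, ¬ |⨍ z in ball y (6 ^ m * r₀), f z| ≤ s :=
    ⟨Nat.find hex, Nat.find_spec hex, fun m hm => Nat.find_min hex hm⟩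
  cases k with
  | zero => simp only [pow_zero, one_mul] at hk; linarith
  | succ k =>
    have h := not_le.1 (hmin k k.lt_succ_self)
    refine ⟨6 ^ k * r₀, by positivity, ?_, h, ?_⟩
    · by_contra! hlt
      exact absurd (hR _ hlt) (not_le.2 h)
    · rwa [← mul_assoc, ← pow_succ']

theorem ae_tendsto_average_ball (hn : 1 ≤ n) (hf : LocallyIntegrable f volume) :
    ∀ᵐ y : EuclideanSpace ℝ (Fin n),
      Tendsto (fun r => ⨍ z in ball y r, f z) (𝓝[>] 0) (𝓝 (f y)) := by
  have : Nonempty (Fin n) := ⟨⟨0, hn⟩⟩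
  filter_upwards [IsUnifLocDoublingMeasure.ae_tendsto_average volume hf 1] with y hy
  have h := hy (l := 𝓝[>] (0 : ℝ)) (fun _ => y) id tendsto_id (by
    filter_upwards [self_mem_nhdsWithin] with r hr
    exact mem_closedBall_self (by simpa using (Set.mem_Ioi.1 hr).le))
  -- The differentiation theorem concerns closed balls; spheres are null.
  refine h.congr fun r => setAverage_congr ?_
  rw [← ball_union_sphere]
  exact union_ae_eq_left_of_ae_eq_empty (ae_eq_empty.2 (Measure.addHaar_sphere volume y r))

/-- The superlevel sets of `|f|` decay geometrically. -/
theorem volume_superlevel_add_le (hn : 1 ≤ n) (hf : Integrable f volume) {K : ℝ} (hKpos : 0 < K)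
    (hK : bmoSeminorm f ≤ ENNReal.ofReal K) {t : ℝ} (ht : 0 ≤ t) :
    volume {y | t + 8 * 6 ^ n * K < |f y|} ≤ 2⁻¹ * volume {y | t < |f y|} := by
  -- Half the gap between the levels: the stopping averages sit around `t + l`. Chebyshev at height
  -- `l` leaves at most a quarter of the small ball, even when applied on the ball dilated by 6.
  set l : ℝ := 4 * 6 ^ n * K with hl
  have hlpos : 0 < l := by positivity
  obtain ⟨R, hR⟩ := exists_abs_average_ball_le hn hf (s := t + l) (by positivity)
  set P : Set (EuclideanSpace ℝ (Fin n) × ℝ) := {p | 0 < p.2 ∧ p.2 ≤ R ∧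
    t + l < |⨍ z in ball p.1 p.2, f z| ∧ |⨍ z in ball p.1 (6 * p.2), f z| ≤ t + l} with hP
  -- Closed balls enlarged by 5 fit into the open balls enlarged by 6, where the average is at most
  -- `t + l`.
  obtain ⟨u, huP, hdisj, hcov⟩ := Vitali.exists_disjoint_subfamily_covering_enlargement_closedBall
    P Prod.fst Prod.snd R (fun p hp => hp.2.1) 5 (by norm_num)
  have hdisj' : u.PairwiseDisjoint fun p => ball p.1 p.2 :=
    fun p hp q hq hpq => (hdisj hp hq hpq).mono ball_subset_closedBall ball_subset_closedBall
  have hcount : u.Countable := hdisj'.countable_of_isOpen (fun p _ => isOpen_ball)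
    fun p hp => nonempty_ball.2 (huP hp).1
  have hcover : {y | t + 8 * 6 ^ n * K < |f y|} ≤ᵐ[volume]
      ⋃ p ∈ u, {y | l ≤ |f y - ⨍ z in ball p.1 (6 * p.2), f z|} ∩ ball p.1 (6 * p.2) := by
    filter_upwards [ae_tendsto_average_ball hn hf.locallyIntegrable] with y hy hty
    have hty : t + 8 * 6 ^ n * K < |f y| := hty
    have hfy : t + l + l < |f y| := by rw [hl]; linarith
    obtain ⟨r, hr, hrR, h1, h2⟩ := exists_stopping_radius (hR y) hy (by linarith)
    obtain ⟨p, hp, hsub⟩ := hcov (y, r) ⟨hr, hrR, h1, h2⟩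
    have hmem : y ∈ closedBall p.1 (5 * p.2) := hsub (mem_closedBall_self hr.le)
    have hp' := huP hp
    refine Set.mem_biUnion hp ⟨?_, ?_⟩
    · have := abs_sub_abs_le_abs_sub (f y) (⨍ z in ball p.1 (6 * p.2), f z)
      have := hp'.2.2.2
      show l ≤ _
      linarith
    · have := hp'.1
      exact closedBall_subset_ball (by linarith) hmem
  have hlocal : ∀ p ∈ u,
      volume ({y | l ≤ |f y - ⨍ z in ball p.1 (6 * p.2), f z|} ∩ ball p.1 (6 * p.2)) ≤
        2⁻¹ * (volume.restrict {y | t < |f y|}) (ball p.1 p.2) := by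
    intro p hp
    obtain ⟨hr, -, h1, -⟩ := huP hp
    have hbig := volume_ball_inter_oscillation_le hf.1 hK p.1
      (r := 6 * p.2) (by positivity) hlpos
    have hsmall := volume_ball_inter_oscillation_le hf.1 hK p.1 hr hlpos
    have hscale : volume (ball p.1 (6 * p.2)) = ENNReal.ofReal (6 ^ n) * volume (ball p.1 p.2) := by
      rw [Measure.addHaar_ball_mul_of_pos volume p.1 (by norm_num : (0 : ℝ) < 6),
        finrank_euclideanSpace_fin, Measure.addHaar_ball_center volume p.1 p.2]
    -- The average exceeds `t + l`, so points with `|f| ≤ t` deviate by at least `l` and fill at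
    -- most a quarter of the ball.
    have hsplit : volume (ball p.1 p.2) ≤
        volume ({y | l ≤ |f y - ⨍ z in ball p.1 p.2, f z|} ∩ ball p.1 p.2) +
          volume (ball p.1 p.2 ∩ {y | t < |f y|}) := by
      refine (measure_mono fun y hy => ?_).trans (measure_union_le _ _)
      by_cases hty : t < |f y|
      · exact Or.inr ⟨hy, hty⟩
      · refine Or.inl ⟨?_, hy⟩
        have := abs_sub_abs_le_abs_sub (⨍ z in ball p.1 p.2, f z) (f y)
        rw [abs_sub_comm] at this
        show l ≤ _
        linarith [not_lt.1 hty]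
    rw [Measure.restrict_apply measurableSet_ball]
    set v := volume (ball p.1 p.2) with hv
    set w := volume (ball p.1 p.2 ∩ {y | t < |f y|}) with hw
    have hvt : v ≠ ∞ := measure_ball_lt_top.ne
    have hwt : w ≠ ∞ := measure_ne_top_of_subset Set.inter_subset_left hvt
    have h6 : (1 : ℝ) ≤ 6 ^ n := one_le_pow₀ (by norm_num)
    have hquarter : K / l ≤ 4⁻¹ := by
      rw [div_le_iff₀ hlpos, hl]; nlinarith
    have hquarter' : K / l * 6 ^ n = 4⁻¹ := by
      rw [hl]; field_simp
    rw [hscale, ← mul_assoc, ← ENNReal.ofReal_mul (by positivity), hquarter'] at hbig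
    refine hbig.trans ?_
    have hhalf : v ≤ ENNReal.ofReal 4⁻¹ * v + w :=
      hsplit.trans (add_le_add_left (hsmall.trans (by gcongr)) _)
    exact quarter_mul_le_half_mul hvt hwt hhalf
  calc volume {y | t + 8 * 6 ^ n * K < |f y|}
      ≤ volume (⋃ p ∈ u,
        {y | l ≤ |f y - ⨍ z in ball p.1 (6 * p.2), f z|} ∩ ball p.1 (6 * p.2)) :=
        measure_mono_ae hcover
    _ ≤ ∑' p : u, volume
        ({y | l ≤ |f y - ⨍ z in ball p.1.1 (6 * p.1.2), f z|} ∩ ball p.1.1 (6 * p.1.2)) :=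
        measure_biUnion_le _ hcount _
    _ ≤ ∑' p : u, 2⁻¹ * (volume.restrict {y | t < |f y|}) (ball p.1.1 p.1.2) :=
        ENNReal.tsum_le_tsum fun p => hlocal p.1 p.2
    _ = 2⁻¹ * ∑' p : u, (volume.restrict {y | t < |f y|}) (ball p.1.1 p.1.2) :=
        ENNReal.tsum_mul_left
    _ ≤ 2⁻¹ * (volume.restrict {y | t < |f y|}) Set.univ := by
        gcongr
        exact (tsum_meas_le_meas_iUnion_of_disjoint _ (fun _ => measurableSet_ball)
          (hdisj'.subtype _ _)).trans (measure_mono (Set.subset_univ _))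
    _ = 2⁻¹ * volume {y | t < |f y|} := by rw [Measure.restrict_apply_univ]

/-- A form of the **John–Nirenberg inequality** for integrable functions. -/
theorem volume_superlevel_le (hn : 1 ≤ n) (hf : Integrable f volume) {K : ℝ} (hKpos : 0 < K)
    (hK : bmoSeminorm f ≤ ENNReal.ofReal K) (k : ℕ) :
    volume {y | k * (8 * 6 ^ n * K) < |f y|} ≤ 2⁻¹ ^ k * volume (Function.support f) := by
  induction k with
  | zero => simp [Function.support]
  | succ k ih =>
    have h := volume_superlevel_add_le hn hf hKpos hK (t := k * (8 * 6 ^ n * K)) (by positivity)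
    have hk : ((k + 1 : ℕ) : ℝ) * (8 * 6 ^ n * K) = k * (8 * 6 ^ n * K) + 8 * 6 ^ n * K := by
      push_cast; ring
    rw [hk, pow_succ', mul_assoc (2⁻¹ : ℝ≥0∞)]
    exact h.trans (by gcongr)

end OscillationEstimates

/-! ### Consequences of bounded support -/

theorem ae_eq_zero_compl_essSupport {n : ℕ} (f : EuclideanSpace ℝ (Fin n) → ℝ) :
    ∀ᵐ x, x ∉ essSupport f → f x = 0 := by
  -- Lindelöf: a countable subfamily has the same union, so the null sets add up to a null set.
  obtain ⟨T, hTc, hTS, hT⟩ := TopologicalSpace.isOpen_sUnion_countable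
    {U | IsOpen U ∧ f =ᵐ[volume.restrict U] 0} fun U hU => hU.1
  have h : ∀ᵐ x, ∀ U ∈ T, x ∈ U → f x = 0 := by
    rw [ae_ball_iff hTc]
    intro U hU
    exact (ae_restrict_iff' (hTS hU).1.measurableSet).1 (hTS hU).2
  filter_upwards [h] with x hx hxs
  rw [essSupport, Set.notMem_compl_iff, ← hT] at hxs
  obtain ⟨U, hU, hxU⟩ := hxs
  exact hx U hU hxU

theorem integrable_of_isBounded_essSupport {n : ℕ} {f : EuclideanSpace ℝ (Fin n) → ℝ}
    (hf : LocallyIntegrable f volume) (hb : Bornology.IsBounded (essSupport f)) :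
    Integrable f volume := by
  obtain ⟨R, hR⟩ := hb.subset_closedBall 0
  have hB := hf.integrableOn_isCompact (isCompact_closedBall (0 : EuclideanSpace ℝ (Fin n)) R)
  refine hB.integrable_of_ae_notMem_eq_zero ?_
  filter_upwards [ae_eq_zero_compl_essSupport f] with x hx hxB
  exact hx fun h => hxB (hR h)

theorem volume_support_le {n : ℕ} {f : EuclideanSpace ℝ (Fin n) → ℝ} {d : ℝ}
    (hb : Bornology.IsBounded (essSupport f)) (hd : Metric.diam (essSupport f) ≤ d) :
    volume (Function.support f) ≤ volume (closedBall (0 : EuclideanSpace ℝ (Fin n)) d) := by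
  have hle : volume (Function.support f) ≤ volume (essSupport f) := by
    refine measure_mono_ae ?_
    filter_upwards [ae_eq_zero_compl_essSupport f] with x hx hxs
    by_contra h
    exact hxs (hx h)
  refine hle.trans ?_
  rcases (essSupport f).eq_empty_or_nonempty with h | ⟨x, hx⟩
  · simp [h]
  · rw [← Measure.addHaar_closedBall_center volume x d]
    exact measure_mono fun y hy => (dist_le_diam_of_mem hb hy hx).trans hd

/-! ### Slicing `|f|` and summing against `g` -/

theorem enorm_le_tsum_indicator_superlevel {α : Type*} (f : α → ℝ) {c : ℝ} (hc : 0 < c) (x : α) :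
    ‖f x‖ₑ ≤ ∑' k : ℕ, {y | k * c < |f y|}.indicator (fun _ => ENNReal.ofReal c) x := by
  refine le_trans ?_ (ENNReal.sum_le_tsum (Finset.range ⌈|f x| / c⌉₊))
  have hterm : ∀ k ∈ Finset.range ⌈|f x| / c⌉₊,
      {y | k * c < |f y|}.indicator (fun _ => ENNReal.ofReal c) x = ENNReal.ofReal c := by
    intro k hk
    refine Set.indicator_of_mem ?_ _
    exact (lt_div_iff₀ hc).1 (Nat.lt_ceil.1 (Finset.mem_range.1 hk))
  rw [Finset.sum_congr rfl hterm, Finset.sum_const, Finset.card_range, nsmul_eq_mul,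
    Real.enorm_eq_ofReal_abs, ← ENNReal.ofReal_natCast, ← ENNReal.ofReal_mul (by positivity)]
  exact ENNReal.ofReal_le_ofReal ((div_le_iff₀ hc).1 (Nat.le_ceil _))

theorem tsum_le_of_le_geometric {a : ℕ → ℝ≥0∞} {A B : ℝ≥0∞} (m : ℕ) (hA : ∀ k, a k ≤ A)
    (hB : ∀ k, a k ≤ 2⁻¹ ^ k * B) (hAB : B ≤ 2 ^ m * A) : ∑' k, a k ≤ (m + 2) * A := by
  rw [← ENNReal.summable.sum_add_tsum_nat_add' (k := m), add_mul]
  refine add_le_add ?_ ?_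
  · calc ∑ k ∈ Finset.range m, a k ≤ ∑ k ∈ Finset.range m, A := Finset.sum_le_sum fun k _ => hA k
      _ = m * A := by simp
  · calc ∑' k, a (k + m) ≤ ∑' k : ℕ, 2⁻¹ ^ k * A := by
          refine ENNReal.tsum_le_tsum fun k => (hB _).trans ?_
          rw [pow_add, mul_assoc]
          gcongr
          rw [← ENNReal.inv_pow, mul_comm, ← div_eq_mul_inv]
          exact ENNReal.div_le_of_le_mul' hAB
      _ = 2 * A := by
          rw [ENNReal.tsum_mul_right, ENNReal.tsum_geometric, ENNReal.one_sub_inv_two, inv_inv]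

theorem lintegral_enorm_mul_le {α : Type*} [MeasurableSpace α] {μ : Measure α} {f g : α → ℝ}
    (hf : AEStronglyMeasurable f μ) (hg : AEStronglyMeasurable g μ) {c : ℝ} (hc : 0 < c)
    {V : ℝ≥0∞} (hV : ∀ k : ℕ, μ {y | k * c < |f y|} ≤ 2⁻¹ ^ k * V) (m : ℕ)
    (hm : eLpNorm g ∞ μ * V ≤ 2 ^ m * eLpNorm g 1 μ) :
    ∫⁻ x, ‖f x * g x‖ₑ ∂μ ≤ ENNReal.ofReal c * ((m + 2) * eLpNorm g 1 μ) := by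
  have hmeas : ∀ k : ℕ, NullMeasurableSet {y | k * c < |f y|} μ := fun k =>
    nullMeasurableSet_lt aemeasurable_const hf.aemeasurable.abs
  calc ∫⁻ x, ‖f x * g x‖ₑ ∂μ
      ≤ ∫⁻ x, ∑' k : ℕ,
        {y | k * c < |f y|}.indicator (fun y => ENNReal.ofReal c * ‖g y‖ₑ) x ∂μ := by
        refine lintegral_mono fun x => ?_
        rw [enorm_mul]
        refine (mul_le_mul_left (enorm_le_tsum_indicator_superlevel f hc x) _).trans ?_
        rw [← ENNReal.tsum_mul_right]
        refine (tsum_congr fun k => ?_).le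
        by_cases h : x ∈ {y | k * c < |f y|}
        · rw [Set.indicator_of_mem h, Set.indicator_of_mem h]
        · rw [Set.indicator_of_notMem h, Set.indicator_of_notMem h, zero_mul]
    _ = ∑' k : ℕ, ENNReal.ofReal c * ∫⁻ x in {y | k * c < |f y|}, ‖g x‖ₑ ∂μ := by
        rw [lintegral_tsum fun k => (hg.enorm.const_mul _).indicator₀ (hmeas k)]
        refine tsum_congr fun k => ?_
        rw [lintegral_indicator₀ (hmeas k), lintegral_const_mul'' _ hg.enorm.restrict]
    _ = ENNReal.ofReal c * ∑' k : ℕ, ∫⁻ x in {y | k * c < |f y|}, ‖g x‖ₑ ∂μ :=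
        ENNReal.tsum_mul_left
    _ ≤ ENNReal.ofReal c * ((m + 2) * eLpNorm g 1 μ) := by
        gcongr
        refine tsum_le_of_le_geometric m (fun k => ?_) (fun k => ?_) hm
        · rw [eLpNorm_one_eq_lintegral_enorm]
          exact setLIntegral_le_lintegral _ _
        · calc ∫⁻ x in {y | k * c < |f y|}, ‖g x‖ₑ ∂μ
              ≤ ∫⁻ _ in {y | k * c < |f y|}, eLpNorm g ∞ μ ∂μ := by
                refine lintegral_mono_ae (ae_restrict_of_ae ?_)
                rw [eLpNorm_exponent_top]
                exact ae_le_eLpNormEssSup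
            _ ≤ eLpNorm g ∞ μ * (2⁻¹ ^ k * V) := by
                rw [setLIntegral_const]
                gcongr
                exact hV k
            _ = 2⁻¹ ^ k * (eLpNorm g ∞ μ * V) := by ring

theorem exists_nat_logarithmic_bound {A M V : ℝ} (hA : 0 < A) (hM : 0 ≤ M) (hV : 1 ≤ V) :
    ∃ m : ℕ, M * V ≤ 2 ^ m * A ∧
      (m + 2 : ℝ) ≤ (5 + 2 * Real.log V) * (|Real.log A| + Real.log (Real.exp 1 + M)) := by
  have hlogV : 0 ≤ Real.log V := Real.log_nonneg hV
  have hlog : 1 ≤ Real.log (Real.exp 1 + M) := by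
    rw [Real.le_log_iff_exp_le (by positivity)]
    linarith
  set X := |Real.log A| + Real.log (Real.exp 1 + M) with hX
  have hX1 : 1 ≤ X := by linarith [abs_nonneg (Real.log A)]
  -- Since `1 ≤ 2 log 2`, `2 ^ ⌈2 * T⌉₊` dominates `exp T`, which is at least `M * V / A`. The bound
  -- `1 ≤ X` absorbs the additive constants into the factor `5 + 2 log V`.
  set T := Real.log V + X with hT
  refine ⟨⌈2 * T⌉₊, ?_, ?_⟩
  · have hle := Nat.le_ceil (2 * T)
    have hpow : Real.exp T ≤ 2 ^ ⌈2 * T⌉₊ := by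
      rw [← Real.exp_log (by norm_num : (0 : ℝ) < 2), ← Real.exp_nat_mul, Real.exp_log (by norm_num)]
      have := Real.log_two_gt_d9
      exact Real.exp_le_exp.2 (by nlinarith)
    have hexp : Real.exp T = V * (Real.exp |Real.log A| * (Real.exp 1 + M)) := by
      rw [hT, hX, Real.exp_add, Real.exp_add, Real.exp_log (by linarith),
        Real.exp_log (by positivity)]
    have hone : 1 ≤ Real.exp |Real.log A| * A := by
      nth_rewrite 2 [← Real.exp_log hA]
      rw [← Real.exp_add, Real.one_le_exp_iff]
      linarith [neg_abs_le (Real.log A)]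
    calc M * V ≤ V * (Real.exp 1 + M) * 1 := by
          nlinarith [Real.exp_pos 1]
      _ ≤ V * (Real.exp 1 + M) * (Real.exp |Real.log A| * A) := by gcongr
      _ = Real.exp T * A := by rw [hexp]; ring
      _ ≤ 2 ^ ⌈2 * T⌉₊ * A := by gcongr
  · have := (Nat.ceil_lt_add_one (by positivity : 0 ≤ 2 * T)).le
    nlinarith

theorem theoremD (n : ℕ) (hn : 1 ≤ n) (d : ℝ) (hd : 0 ≤ d) :
    ∃ C₀ : ℝ, 0 < C₀ ∧
      ∀ f g : EuclideanSpace ℝ (Fin n) → ℝ,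
        MemBMO f →
        Bornology.IsBounded (essSupport f) → Metric.diam (essSupport f) ≤ d →
        MemLp g 1 volume → MemLp g ∞ volume →
        Integrable (fun x => f x * g x) volume ∧
          |∫ x, f x * g x ∂volume| ≤
            C₀ * (bmoSeminorm f).toReal * (eLpNorm g 1 volume).toReal *
              (|Real.log (eLpNorm g 1 volume).toReal| +
                Real.log (Real.exp 1 + (eLpNorm g ∞ volume).toReal)) := by
  -- The maximum with 1 keeps `log V` nonnegative.
  set V : ℝ := max 1 (volume.real (closedBall (0 : EuclideanSpace ℝ (Fin n)) d)) with hV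
  have hV1 : 1 ≤ V := le_max_left _ _
  have hlogV : 0 ≤ Real.log V := Real.log_nonneg hV1
  refine ⟨8 * 6 ^ n * (5 + 2 * Real.log V), by positivity, fun f g hf hb hdiam hg1 hg => ?_⟩
  have hfint := integrable_of_isBounded_essSupport hf.1 hb
  have hsupp : volume (Function.support f) ≤ ENNReal.ofReal V := by
    refine (volume_support_le hb hdiam).trans ?_
    rw [← ofReal_measureReal measure_closedBall_lt_top.ne]
    exact ENNReal.ofReal_le_ofReal (le_max_right _ _)
  set A := (eLpNorm g 1 volume).toReal with hA
  set M := (eLpNorm g ∞ volume).toReal with hM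
  set X := |Real.log A| + Real.log (Real.exp 1 + M) with hX
  have hA' : eLpNorm g 1 volume = ENNReal.ofReal A := (ENNReal.ofReal_toReal hg1.2.ne).symm
  have hM' : eLpNorm g ∞ volume = ENNReal.ofReal M := (ENNReal.ofReal_toReal hg.2.ne).symm
  have hA0 : 0 ≤ A := ENNReal.toReal_nonneg
  have hM0 : 0 ≤ M := ENNReal.toReal_nonneg
  rcases hA0.eq_or_lt with hAz | hApos
  · have hgz : g =ᵐ[volume] 0 := by
      rw [← hAz, ENNReal.ofReal_zero, eLpNorm_eq_zero_iff hg1.1 one_ne_zero] at hA'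
      exact hA'
    have hfg : (fun x => f x * g x) =ᵐ[volume] 0 := by
      filter_upwards [hgz] with x hx
      simp [hx]
    refine ⟨(integrable_zero _ _ _).congr hfg.symm, ?_⟩
    rw [integral_congr_ae hfg, ← hAz]
    simp
  obtain ⟨m, hm, hmX⟩ := exists_nat_logarithmic_bound hApos hM0 hV1
  -- The decay estimate needs `0 < K`, while the seminorm may vanish; `K` is finally sent down to
  -- the seminorm.
  have key : ∀ K : ℝ, (bmoSeminorm f).toReal < K →
      ∫⁻ x, ‖f x * g x‖ₑ ≤ ENNReal.ofReal (8 * 6 ^ n * (5 + 2 * Real.log V) * K * A * X) := by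
    intro K hK
    have hKpos : 0 < K := ENNReal.toReal_nonneg.trans_lt hK
    have hK' : bmoSeminorm f ≤ ENNReal.ofReal K := by
      rw [ENNReal.le_ofReal_iff_toReal_le hf.2.ne hKpos.le]
      exact hK.le
    refine (lintegral_enorm_mul_le hfint.1 hg1.1 (c := 8 * 6 ^ n * K) (by positivity)
      (V := ENNReal.ofReal V) (fun k => ?_) m ?_).trans ?_
    · exact (volume_superlevel_le hn hfint hKpos hK' k).trans (by gcongr)
    · rw [hA', hM', ← ENNReal.ofReal_mul hM0, ← ENNReal.ofReal_ofNat 2,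
        ← ENNReal.ofReal_pow (by norm_num), ← ENNReal.ofReal_mul (by positivity)]
      exact ENNReal.ofReal_le_ofReal hm
    · have hm2 : (m + 2 : ℝ≥0∞) = ENNReal.ofReal (m + 2) := by
        rw [ENNReal.ofReal_add (by positivity) (by norm_num)]
        simp
      rw [hA', hm2, ← ENNReal.ofReal_mul (by positivity), ← ENNReal.ofReal_mul (by positivity)]
      refine ENNReal.ofReal_le_ofReal ?_
      calc 8 * 6 ^ n * K * ((m + 2) * A)
          ≤ 8 * 6 ^ n * K * ((5 + 2 * Real.log V) * X * A) := by gcongr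
        _ = 8 * 6 ^ n * (5 + 2 * Real.log V) * K * A * X := by ring
  have hint : Integrable (fun x => f x * g x) volume :=
    ⟨hfint.1.mul hg1.1, (key _ (lt_add_one _)).trans_lt ENNReal.ofReal_lt_top⟩
  refine ⟨hint, ?_⟩
  have hX0 : 0 ≤ X := add_nonneg (abs_nonneg _)
    (Real.log_nonneg (by linarith [Real.add_one_le_exp (1 : ℝ)]))
  have hreal : ∀ K : ℝ, (bmoSeminorm f).toReal < K →
      |∫ x, f x * g x| ≤ 8 * 6 ^ n * (5 + 2 * Real.log V) * K * A * X := by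
    intro K hK
    have hKpos : 0 < K := ENNReal.toReal_nonneg.trans_lt hK
    have h := (enorm_integral_le_lintegral_enorm _).trans (key K hK)
    rwa [Real.enorm_eq_ofReal_abs, ENNReal.ofReal_le_ofReal_iff (by positivity)] at h
  have hlim : Tendsto (fun K : ℝ => 8 * 6 ^ n * (5 + 2 * Real.log V) * K * A * X)
      (𝓝[>] (bmoSeminorm f).toReal)
      (𝓝 (8 * 6 ^ n * (5 + 2 * Real.log V) * (bmoSeminorm f).toReal * A * X)) :=
    (Continuous.tendsto (by fun_prop) _).mono_left nhdsWithin_le_nhds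
  exact ge_of_tendsto hlim (by filter_upwards [self_mem_nhdsWithin] with K hK using hreal K hK)
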